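/- Let $G$ be a compact group. Let $\mathbb{C}[G]\subset C(G)$ be the algebra spanned by the matrix coefficients $c^\pi_{\xi,\eta}(t)=\langle\pi(t)\xi,\eta\rangle$ of finite-dimensional unitary representations $\pi$ of $G$, and let $\mathcal{U}(G)=\mathbb{C}[G]^*$ be its algebraic dual, with pairing $(x,f)$. Every finite-dimensional unitary representation $(\pi,\mathcal{K})$ of $G$ extends to $\mathcal{U}(G)$ by $\langle\pi(x)\xi,\eta\rangle=(x,c^\pi_{\xi,\eta})$. Let $m\ge 0$. An element $x\in\mathbb{M}_m(\mathbb{C})\otimes\mathcal{U}(G)$ is called positive if $(\mathrm{id}_m\otimes\pi)(x)\ge 0$ in $\mathbb{M}_m(\mathbb{C})\otimes B(\mathcal{K})$ for every finite-dimensional unitary representation $(\pi,\mathcal{K})$, and $y\le x$ means that $x-y$ is positive. Let $(\Pi,\mathcal{H})$ be a finite-dimensional unitary representation of $G$, and let $\rho$ be a faithful positive linear functional on $B(\mathcal{H})$. Let $f_\rho\in\mathbb{C}[G]$ be the element with $(x,f_\rho)=\rho(\Pi(x))$ for all $x\in\mathcal{U}(G)$, let $P_\rho\colon\mathcal{U}(G)\to\mathcal{U}(G)$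 be given by $(P_\rho(x),f)=(x,ff_\rho)$, and put $P_{m,\rho}=\mathrm{id}_m\otimes P_\rho$. Define $$B_{m,\rho}=\{x\in\mathbb{M}_m(\mathbb{C})\otimes\mathcal{U}(G)\mid x\ge 0,\ P_{m,\rho}(x)\le x\},$$ and let $K_{m,\rho}$ be the set of all sequences $(x_l)_{l\ge 0}$ such that, for every $l\geq 0$, $x_l$ is a positive element of $\mathbb{M}_m(\mathbb{C})\otimes (B(\mathcal{H})^{\otimes l})^{S_l}$ (the elements invariant under permutations of the $l$ tensor factors; $B(\mathcal{H})^{\otimes 0}=\mathbb{C}$) and $$(\mathrm{id}_m\otimes\mathrm{id}_{B(\mathcal{H})}^{\otimes l}\otimes\rho)(x_{l+1})\le x_l .$$ Finally, let $\Pi_{m,\infty}(x)=\bigl((\mathrm{id}_m\otimes\Pi^{\otimes l})(x)\bigr)_{l\ge 0}$ for $x\in\mathbb{M}_m(\mathbb{C})\otimes\mathcal{U}(G)$, where $\Pi^{\otimes l}$ is the extension to $\mathcal{U}(G)$ of the $l$-fold tensor power of $\Pi$ and $\Pi^{\otimes 0}$ that of the trivial one-dimensional representation. Then $\Pi_{m,\infty}(B_{m,\rho})\subseteq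 K_{m,\rho}$. Moreover, if $\Pi$ is generating, that is, if every irreducible unitary representation of $G$ is a sub-representation of $\Pi^{\otimes l}$ for some $l\ge 0$, then $\Pi_{m,\infty}$ is injective on $\mathbb{M}_m(\mathbb{C})\otimes\mathcal{U}(G)$. -/

import Mathlib

open scoped ComplexOrder Matrix

noncomputable section

namespace QRW

/-! ### Finite-dimensional unitary representations in matrix form -/

section Reps

variable (G : Type*) [Group G] [TopologicalSpace G]

/-- A finite-dimensional (continuous) unitary representation of `G` on `ℂ^ι`, i.e. on the
finite-dimensional Hilbert space with orthonormal basis indexed by the finite type `ι`. -/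
abbrev URep (ι : Type*) [Fintype ι] [DecidableEq ι] : Type _ :=
  G →ₜ* Matrix.unitaryGroup ι ℂ

variable {G}
variable {ι κ : Type*} [Fintype ι] [DecidableEq ι] [Fintype κ] [DecidableEq κ]

/-- The matrix coefficient `t ↦ ⟨π(t) ξ, η⟩` (linear in `ξ`, conjugate-linear in `η`). -/
def coeffVec (π : URep G ι) (ξ η : ι → ℂ) : C(G, ℂ) where
  toFun t := ((π t : Matrix ι ι ℂ) *ᵥ ξ) ⬝ᵥ star η
  continuous_toFun := by
    have h : Continuous fun t => (π t : Matrix ι ι ℂ) :=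
      continuous_subtype_val.comp π.continuous_toFun
    fun_prop

@[simp] theorem coeffVec_apply (π : URep G ι) (ξ η : ι → ℂ) (t : G) :
    coeffVec π ξ η t = ((π t : Matrix ι ι ℂ) *ᵥ ξ) ⬝ᵥ star η := rfl

/-- The tensor product of two unitary representations. -/
def tensor (π : URep G ι) (τ : URep G κ) : URep G (ι × κ) where
  toFun t := ⟨Matrix.kronecker (π t : Matrix ι ι ℂ) (τ t : Matrix κ κ ℂ),
    Matrix.kronecker_mem_unitary (π t).2 (τ t).2⟩
  map_one' := Subtype.ext (by simp [Matrix.kronecker])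
  map_mul' s t := Subtype.ext (by
    simp [Matrix.kronecker, Matrix.mul_kronecker_mul])
  continuous_toFun := by
    have h : Continuous fun t => (π t : Matrix ι ι ℂ) :=
      continuous_subtype_val.comp π.continuous_toFun
    have h' : Continuous fun t => (τ t : Matrix κ κ ℂ) :=
      continuous_subtype_val.comp τ.continuous_toFun
    refine Continuous.subtype_mk (continuous_matrix fun i j => ?_) _
    exact (h.matrix_elem i.1 j.1).mul (h'.matrix_elem i.2 j.2)

theorem tensor_apply (π : URep G ι) (τ : URep G κ) (t : G) (p q : ι × κ) :
    (tensor π τ t : Matrix (ι × κ) (ι × κ) ℂ) p q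
      = (π t : Matrix ι ι ℂ) p.1 q.1 * (τ t : Matrix κ κ ℂ) p.2 q.2 := rfl

/-- The `l`-fold Kronecker power of a matrix, i.e. `A ⊗ ⋯ ⊗ A` acting on `(ℂ^ι)^{⊗ l}`, whose
standard basis is indexed by `Fin l → ι`. For `l = 0` it is the `1 × 1` matrix `1`. -/
def kronPow (l : ℕ) (A : Matrix ι ι ℂ) : Matrix (Fin l → ι) (Fin l → ι) ℂ :=
  Matrix.of fun I J => ∏ k, A (I k) (J k)

theorem kronPow_mul (l : ℕ) (A B : Matrix ι ι ℂ) :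
    kronPow l (A * B) = kronPow l A * kronPow l B := by
  ext I J
  simp only [kronPow, Matrix.of_apply, Matrix.mul_apply, ← Finset.prod_mul_distrib]
  rw [Finset.prod_univ_sum, Fintype.piFinset_univ]

theorem kronPow_one (l : ℕ) : kronPow l (1 : Matrix ι ι ℂ) = 1 := by
  ext I J
  simp only [kronPow, Matrix.of_apply, Matrix.one_apply, Finset.prod_ite_zero, funext_iff]
  simp

theorem kronPow_star (l : ℕ) (A : Matrix ι ι ℂ) :
    kronPow l (star A) = star (kronPow l A) := by
  ext I J
  simp [kronPow, Matrix.star_apply]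

/-- The `l`-fold tensor power `(Π^{⊗ l}, H^{⊗ l})` of a unitary representation; for `l = 0` it is
the trivial one-dimensional representation. -/
def tensorPow (π : URep G ι) (l : ℕ) : URep G (Fin l → ι) where
  toFun t := ⟨kronPow l (π t : Matrix ι ι ℂ), by
    rw [Matrix.mem_unitaryGroup_iff, ← kronPow_star, ← kronPow_mul,
      Matrix.mem_unitaryGroup_iff.1 (π t).2, kronPow_one]⟩
  map_one' := Subtype.ext (by simp [kronPow_one])
  map_mul' s t := Subtype.ext (by simp [kronPow_mul])
  continuous_toFun := by
    have h : Continuous fun t => (π t : Matrix ι ι ℂ) :=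
      continuous_subtype_val.comp π.continuous_toFun
    refine Continuous.subtype_mk (continuous_matrix fun i j => ?_) _
    simp only [kronPow, Matrix.of_apply]
    exact continuous_finsetProd _ fun k _ => h.matrix_elem (i k) (j k)

/-- The underlying linear representation on `ι → ℂ`. -/
def toRep (π : URep G ι) : Representation ℂ G (ι → ℂ) where
  toFun t := Matrix.toLin' (π t : Matrix ι ι ℂ)
  map_one' := by simp [Module.End.one_eq_id]
  map_mul' s t := by simp [Matrix.toLin'_mul, Module.End.mul_eq_comp]

/-- `π` is (unitarily equivalent to) a sub-representation of `τ`: there is an isometry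
`V : ℂ^ι → ℂ^κ` that intertwines `π` and `τ`. -/
def IsSubrep (π : URep G ι) (τ : URep G κ) : Prop :=
  ∃ V : Matrix κ ι ℂ, Vᴴ * V = 1 ∧
    ∀ t, V * (π t : Matrix ι ι ℂ) = (τ t : Matrix κ κ ℂ) * V

/-- `Π` generates the dual of `G`: every irreducible unitary representation of `G` is a
sub-representation of some tensor power of `Π`. -/
def Generating (P : URep G ι) : Prop :=
  ∀ (κ : Type) [Fintype κ] [DecidableEq κ] (π : URep G κ), (toRep π).IsIrreducible →
    ∃ l : ℕ, IsSubrep π (tensorPow P l)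

end Reps

/-! ### The algebra `ℂ[G]` and its dual `𝒰(G)` -/

section Algebra

variable (G : Type*) [Group G] [TopologicalSpace G]

/-- All matrix coefficients of finite-dimensional unitary representations. Every such
representation is unitarily equivalent to one on `ℂ^ι` with `ι` a finite type, and equivalent
representations have the same matrix coefficients. -/
def matrixCoeffs : Set C(G, ℂ) :=
  {f | ∃ (ι : Type) (_ : Fintype ι) (_ : DecidableEq ι) (π : URep G ι) (ξ η : ι → ℂ),
    f = coeffVec π ξ η}

theorem one_mem_matrixCoeffs : (1 : C(G, ℂ)) ∈ matrixCoeffs G :=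
  ⟨Unit, inferInstance, inferInstance, 1, 1, 1, by
    ext t; simp [coeffVec_apply, dotProduct]⟩

theorem mul_mem_matrixCoeffs {f g : C(G, ℂ)} (hf : f ∈ matrixCoeffs G)
    (hg : g ∈ matrixCoeffs G) : f * g ∈ matrixCoeffs G := by
  obtain ⟨ι, _, _, π, ξ, η, rfl⟩ := hf
  obtain ⟨κ, _, _, τ, ξ', η', rfl⟩ := hg
  refine ⟨ι × κ, inferInstance, inferInstance, tensor π τ, fun p => ξ p.1 * ξ' p.2,
    fun p => η p.1 * η' p.2, ?_⟩
  ext t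
  simp only [ContinuousMap.mul_apply, coeffVec_apply, dotProduct, Matrix.mulVec, tensor_apply,
    Fintype.sum_prod_type, Pi.star_apply, star_mul']
  rw [Finset.sum_mul_sum]
  refine Finset.sum_congr rfl fun i _ => Finset.sum_congr rfl fun j _ => ?_
  rw [mul_mul_mul_comm, Finset.sum_mul_sum]
  congr 1
  refine Finset.sum_congr rfl fun i _ => Finset.sum_congr rfl fun j _ => ?_
  ring

/-- `ℂ[G] ⊆ C(G)`: the linear span of all matrix coefficients. It is a subalgebra of `C(G)`. -/
def RegAlg : Subalgebra ℂ C(G, ℂ) :=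
  (Submodule.span ℂ (matrixCoeffs G)).toSubalgebra
    (Submodule.subset_span (one_mem_matrixCoeffs G))
    (fun f g hf hg => by
      have h : f * g ∈ Submodule.span ℂ (matrixCoeffs G) * Submodule.span ℂ (matrixCoeffs G) :=
        Submodule.mul_mem_mul hf hg
      rw [Submodule.span_mul_span] at h
      refine Submodule.span_mono ?_ h
      rintro _ ⟨a, ha, b, hb, rfl⟩
      exact mul_mem_matrixCoeffs G ha hb)

/-- `𝒰(G)`: the algebraic dual of `ℂ[G]`. -/
abbrev UAlg : Type _ := Module.Dual ℂ (RegAlg G)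

variable {G}
variable {ι : Type} [Fintype ι] [DecidableEq ι]

/-- The matrix coefficient `c_{ij} : t ↦ π(t)_{ij} = ⟨π(t) e_j, e_i⟩` as an element of `ℂ[G]`. -/
def coeff (π : URep G ι) (i j : ι) : RegAlg G :=
  ⟨coeffVec π (Pi.single j 1) (Pi.single i 1),
    Submodule.subset_span ⟨ι, inferInstance, inferInstance, π, _, _, rfl⟩⟩

theorem coeff_apply (π : URep G ι) (i j : ι) (t : G) :
    (coeff π i j : C(G, ℂ)) t = (π t : Matrix ι ι ℂ) i j := by
  simp [coeff]

theorem coeff_tensorPow (π : URep G ι) (l : ℕ) (I J : Fin l → ι) :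
    coeff (tensorPow π l) I J = ∏ k, coeff π (I k) (J k) := by
  apply Subtype.ext
  ext t
  have h : ((∏ k, coeff π (I k) (J k) : RegAlg G) : C(G, ℂ)) t
      = ∏ k, (coeff π (I k) (J k) : C(G, ℂ)) t := by
    rw [← ContinuousMap.prod_apply]
    congr 1
    exact map_prod (RegAlg G).val _ _
  rw [h, coeff_apply]
  simp only [coeff_apply]
  rfl

/-- The extension of `π` to `𝒰(G)`: the matrix `π(x)` with `⟨π(x) e_j, e_i⟩ = (x, c_{ij})`. -/
def applyRep (π : URep G ι) (x : UAlg G) : Matrix ι ι ℂ :=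
  Matrix.of fun i j => x (coeff π i j)

/-- For a linear functional `ρ` on matrices, the element `f_ρ ∈ ℂ[G]` that represents
`ρ ∘ π ∈ 𝒰(G)_*`, see `apply_reprElem`. -/
def reprElem (π : URep G ι) (ρ : Matrix ι ι ℂ →ₗ[ℂ] ℂ) : RegAlg G :=
  ∑ i, ∑ j, ρ (Matrix.single i j 1) • coeff π i j

theorem apply_reprElem (π : URep G ι) (ρ : Matrix ι ι ℂ →ₗ[ℂ] ℂ) (x : UAlg G) :
    x (reprElem π ρ) = ρ (applyRep π x) := by
  conv_rhs => rw [Matrix.matrix_eq_sum_single (applyRep π x)]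
  simp only [reprElem, map_sum, map_smul, smul_eq_mul]
  refine Finset.sum_congr rfl fun i _ => Finset.sum_congr rfl fun j _ => ?_
  have : Matrix.single i j (applyRep π x i j) = (x (coeff π i j)) • Matrix.single i j (1 : ℂ) := by
    simp [applyRep]
  rw [this, map_smul, smul_eq_mul, mul_comm]

/-- For `f = f_ρ ∈ ℂ[G]`, the operator `P_ρ` on `𝒰(G)`: `(P_ρ(x), g) = (x, g f_ρ)`. -/
def transition (f : RegAlg G) : UAlg G →ₗ[ℂ] UAlg G where
  toFun x := x ∘ₗ LinearMap.mulRight ℂ f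
  map_add' _ _ := rfl
  map_smul' _ _ := rfl

end Algebra

/-! ### The cones -/

section Cones

variable {G : Type*} [Group G] [TopologicalSpace G]
variable {ι : Type} [Fintype ι] [DecidableEq ι] {m : ℕ}

variable (G m) in
/-- `𝕄_m(ℂ) ⊗ 𝒰(G)`, as `m × m` matrices with entries in `𝒰(G)`. -/
abbrev MatU : Type _ := Matrix (Fin m) (Fin m) (UAlg G)

/-- `(id_m ⊗ π)(x) ∈ 𝕄_m(ℂ) ⊗ B(ℂ^ι)`, as a matrix over `Fin m × ι`. -/
def amplify (π : URep G ι) (x : MatU G m) : Matrix (Fin m × ι) (Fin m × ι) ℂ :=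
  Matrix.of fun p q => applyRep π (x p.1 q.1) p.2 q.2

/-- Positivity in `𝕄_m(ℂ) ⊗ 𝒰(G)`: `(id_m ⊗ π)(x)` is positive for every finite-dimensional
unitary representation `π` of `G`. -/
def IsPos (x : MatU G m) : Prop :=
  ∀ (ι : Type) [Fintype ι] [DecidableEq ι] (π : URep G ι), (amplify π x).PosSemidef

/-- The convex cone `B_{m, ρ}` of `P_{m, ρ}`-subharmonic elements, for `ρ ∈ 𝒰(G)_*` represented by
`f ∈ ℂ[G]`: the positive `x` with `P_{m, ρ}(x) ≤ x`, where `P_{m, ρ} = id_m ⊗ P_ρ`. -/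
def subharmonicCone (m : ℕ) (f : RegAlg G) : Set (MatU G m) :=
  {x | IsPos x ∧ IsPos (x - x.map (transition f))}

/-- `id_m ⊗ id^{⊗ l} ⊗ ρ` from `𝕄_m(ℂ) ⊗ 𝕄_ι(ℂ)^{⊗ (l+1)}` to `𝕄_m(ℂ) ⊗ 𝕄_ι(ℂ)^{⊗ l}`. -/
def slice (ρ : Matrix ι ι ℂ →ₗ[ℂ] ℂ) {l : ℕ}
    (X : Matrix (Fin m × (Fin (l + 1) → ι)) (Fin m × (Fin (l + 1) → ι)) ℂ) :
    Matrix (Fin m × (Fin l → ι)) (Fin m × (Fin l → ι)) ℂ :=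
  Matrix.of fun p q => ρ (Matrix.of fun a b =>
    X (p.1, Fin.snoc (α := fun _ => ι) p.2 a) (q.1, Fin.snoc (α := fun _ => ι) q.2 b))

/-- The action of `σ ∈ S_l` on `𝕄_m(ℂ) ⊗ 𝕄_ι(ℂ)^{⊗ l}` by
`a ⊗ x_1 ⊗ ⋯ ⊗ x_l ↦ a ⊗ x_{σ(1)} ⊗ ⋯ ⊗ x_{σ(l)}`. -/
def permute {l : ℕ} (σ : Equiv.Perm (Fin l))
    (X : Matrix (Fin m × (Fin l → ι)) (Fin m × (Fin l → ι)) ℂ) :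
    Matrix (Fin m × (Fin l → ι)) (Fin m × (Fin l → ι)) ℂ :=
  Matrix.of fun p q => X (p.1, p.2 ∘ σ.symm) (q.1, q.2 ∘ σ.symm)

/-- The formula for the action on elementary tensors. -/
theorem permute_elementary {l : ℕ} (σ : Equiv.Perm (Fin l)) (a : Matrix (Fin m) (Fin m) ℂ)
    (x : Fin l → Matrix ι ι ℂ) :
    permute σ (Matrix.of fun p q => a p.1 q.1 * ∏ k, x k (p.2 k) (q.2 k))
      = Matrix.of fun p q => a p.1 q.1 * ∏ k, x (σ k) (p.2 k) (q.2 k) := by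
  ext p q
  simp only [permute, Matrix.of_apply, Function.comp_apply]
  congr 1
  rw [← Equiv.prod_comp σ]
  simp

/-- The convex cone `K_{m, ρ}` of sub-martingale sequences of symmetric elements: sequences of
positive `S_l`-invariant `x_l ∈ 𝕄_m(ℂ) ⊗ 𝕄_ι(ℂ)^{⊗ l}` with
`(id_m ⊗ id^{⊗ l} ⊗ ρ)(x_{l+1}) ≤ x_l`. -/
def submartingaleCone (m : ℕ) (ρ : Matrix ι ι ℂ →ₗ[ℂ] ℂ) :
    Set ((l : ℕ) → Matrix (Fin m × (Fin l → ι)) (Fin m × (Fin l → ι)) ℂ) :=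
  {X | ∀ l, (X l).PosSemidef ∧ (∀ σ : Equiv.Perm (Fin l), permute σ (X l) = X l) ∧
    (X l - slice ρ (X (l + 1))).PosSemidef}

/-- `Π_{m, ∞}(x) = ((id_m ⊗ Π^{⊗ l})(x))_{l ≥ 0}`. -/
def repSeq (m : ℕ) (P : URep G ι) (x : MatU G m) :
    (l : ℕ) → Matrix (Fin m × (Fin l → ι)) (Fin m × (Fin l → ι)) ℂ :=
  fun l => amplify (tensorPow P l) x

end Cones

/-! ### The identification `B(H) = 𝕄_n(ℂ)` given by an orthonormal basis of `H` -/

section Coordinates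

variable {G : Type*} [Group G] [TopologicalSpace G]
variable {H : Type*} [NormedAddCommGroup H] [InnerProductSpace ℂ H] [CompleteSpace H]
variable {n : ℕ}

/-- The `*`-isomorphism `B(H) ≅ 𝕄_n(ℂ)` given by an orthonormal basis of `H`. -/
def opEquiv (b : OrthonormalBasis (Fin n) ℂ H) :
    (H →L[ℂ] H) ≃⋆ₐ[ℂ] Matrix (Fin n) (Fin n) ℂ :=
  b.repr.conjStarAlgEquiv.trans (Matrix.toEuclideanCLM (n := Fin n) (𝕜 := ℂ)).symm

theorem opEquiv_apply (b : OrthonormalBasis (Fin n) ℂ H) (A : H →L[ℂ] H) (i j : Fin n) :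
    opEquiv b A i j = inner ℂ (b i) (A (b j)) := by
  have key : ∀ M : Matrix (Fin n) (Fin n) ℂ,
      M i j = (Matrix.toEuclideanCLM (n := Fin n) (𝕜 := ℂ) M (EuclideanSpace.single j 1)) i := by
    intro M
    simp [Matrix.ofLp_toEuclideanCLM]
  rw [key (opEquiv b A)]
  simp [opEquiv, OrthonormalBasis.repr_apply_apply]

/-- A unitary representation on `H`, in the coordinates given by an orthonormal basis. -/
def toMatrixRep (b : OrthonormalBasis (Fin n) ℂ H) (P : G →ₜ* unitary (H →L[ℂ] H)) :
    URep G (Fin n) where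
  toFun t := ⟨opEquiv b (P t : H →L[ℂ] H), Unitary.map_mem (opEquiv b) (P t).2⟩
  map_one' := by ext1; simp
  map_mul' s t := by ext1; simp
  continuous_toFun := by
    have h : Continuous fun t => (P t : H →L[ℂ] H) :=
      continuous_subtype_val.comp P.continuous_toFun
    refine Continuous.subtype_mk (continuous_matrix fun i j => ?_) _
    simp only [opEquiv_apply]
    fun_prop

/-- A linear functional on `B(H)`, as a functional on `𝕄_n(ℂ)`. -/
def toMatrixFunctional (b : OrthonormalBasis (Fin n) ℂ H) (ρ : (H →L[ℂ] H) →ₗ[ℂ] ℂ) :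
    Matrix (Fin n) (Fin n) ℂ →ₗ[ℂ] ℂ :=
  ρ ∘ₗ ((opEquiv b).symm : Matrix (Fin n) (Fin n) ℂ ≃⋆ₐ[ℂ] (H →L[ℂ] H)).toAlgEquiv.toLinearMap

/-- `ρ` is a positive linear functional on `B(H)`. -/
def PositiveFunctional (ρ : (H →L[ℂ] H) →ₗ[ℂ] ℂ) : Prop :=
  ∀ A : H →L[ℂ] H, A.IsPositive → 0 ≤ ρ A

/-- `ρ` is faithful: strictly positive on non-zero positive operators. -/
def FaithfulFunctional (ρ : (H →L[ℂ] H) →ₗ[ℂ] ℂ) : Prop :=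
  ∀ A : H →L[ℂ] H, A.IsPositive → A ≠ 0 → 0 < ρ A

end Coordinates

end QRW

end

namespace QRW

/-! ### Coefficients of tensor powers and the inclusion of cones -/

section Cone

variable {G : Type*} [Group G] [TopologicalSpace G]
variable {ι : Type} [Fintype ι] [DecidableEq ι] {m : ℕ}

/-! A coefficient of `Π^{⊗ l}` is a product of `l` coefficients of `Π` in the commutative algebra
`ℂ[G]`. Commutativity makes `Π^{⊗ l}(x)` invariant under `S_l`. Splitting off the last factor shows
that applying `ρ` to the last leg is multiplication by `f_ρ` inside the argument of `x`, that is,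
`(id ⊗ ρ) Π^{⊗ (l+1)}(x) = Π^{⊗ l}(P_ρ(x))` (`slice_amplify_tensorPow`). The submartingale
inequality is therefore `P_ρ(x) ≤ x` tested in the representation `Π^{⊗ l}`.

For injectivity, the sequence records the values of `x` on the coefficients of all `Π^{⊗ l}`, so it
suffices that these span `ℂ[G]` (`span_coeff_tensorPow_eq_top`). Generation gives the coefficients
of the irreducibles by compression; complete reducibility (`coeff_mem_of_forall_irreducible`) gives
the rest. -/

theorem coeff_tensorPow_comp_perm (P : URep G ι) {l : ℕ} (σ : Equiv.Perm (Fin l))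
    (I J : Fin l → ι) :
    coeff (tensorPow P l) (I ∘ σ) (J ∘ σ) = coeff (tensorPow P l) I J := by
  simp only [coeff_tensorPow, Function.comp_apply]
  exact Equiv.prod_comp σ fun k => coeff P (I k) (J k)

theorem coeff_tensorPow_snoc (P : URep G ι) {l : ℕ} (I J : Fin l → ι) (a b : ι) :
    coeff (tensorPow P (l + 1)) (Fin.snoc (α := fun _ => ι) I a) (Fin.snoc (α := fun _ => ι) J b)
      = coeff (tensorPow P l) I J * coeff P a b := by
  simp only [coeff_tensorPow, Fin.prod_univ_castSucc, Fin.snoc_castSucc, Fin.snoc_last]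

theorem permute_amplify_tensorPow (P : URep G ι) (x : MatU G m) {l : ℕ}
    (σ : Equiv.Perm (Fin l)) :
    permute σ (amplify (tensorPow P l) x) = amplify (tensorPow P l) x := by
  ext p q
  simp only [permute, amplify, applyRep, Matrix.of_apply, coeff_tensorPow_comp_perm]

theorem slice_amplify_tensorPow (P : URep G ι) (ρ : Matrix ι ι ℂ →ₗ[ℂ] ℂ) (x : MatU G m)
    (l : ℕ) :
    slice ρ (amplify (tensorPow P (l + 1)) x)
      = amplify (tensorPow P l) (x.map (transition (reprElem P ρ))) := by
  ext p q
  -- The functional `g ↦ (x_{pq}, c_{IJ} g)` is itself an element of `𝒰(G)`. Pairing it with `f_ρ`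
  -- applies `ρ` to its image under `Π`.
  have h := apply_reprElem P ρ
    (x p.1 q.1 ∘ₗ LinearMap.mulLeft ℂ (coeff (tensorPow P l) p.2 q.2))
  simp only [slice, amplify, applyRep, Matrix.of_apply, coeff_tensorPow_snoc, Matrix.map_apply]
  exact h.symm

theorem amplify_sub (P : URep G ι) (x y : MatU G m) :
    amplify P (x - y) = amplify P x - amplify P y := by
  ext p q
  simp [amplify, applyRep]

theorem mapsTo_repSeq (P : URep G ι) (ρ : Matrix ι ι ℂ →ₗ[ℂ] ℂ) :
    Set.MapsTo (repSeq m P) (subharmonicCone m (reprElem P ρ)) (submartingaleCone m ρ) := by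
  intro x hx l
  refine ⟨hx.1 _ _, fun σ => permute_amplify_tensorPow P x σ, ?_⟩
  have h := hx.2 _ (tensorPow P l)
  rwa [amplify_sub, ← slice_amplify_tensorPow] at h

end Cone

/-! ### Complete reducibility and injectivity -/

section Decomposition

variable {G : Type*} [Group G] [TopologicalSpace G]
variable {ι κ : Type} [Fintype ι] [DecidableEq ι] [Fintype κ] [DecidableEq κ]

/-- Entries of `A τ(t) B` are fixed linear combinations of coefficients of `τ`. This serves both to
compress to a subrepresentation and to reassemble a direct sum. -/
theorem exists_mem_apply_eq_mul_mul {S : Submodule ℂ (RegAlg G)} {τ : URep G κ}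
    (hτ : ∀ a b, coeff τ a b ∈ S) {α : Type*} (A : Matrix α κ ℂ) (B : Matrix κ α ℂ)
    (i j : α) : ∃ f ∈ S, ∀ t, (f : C(G, ℂ)) t = (A * (τ t : Matrix κ κ ℂ) * B) i j := by
  refine ⟨∑ b, ∑ a, (A i a * B b j) • coeff τ a b,
    S.sum_mem fun b _ => S.sum_mem fun a _ => S.smul_mem _ (hτ a b), fun t => ?_⟩
  simp only [AddSubmonoidClass.coe_finsetSum, ContinuousMap.coe_sum, Finset.sum_apply,
    SetLike.val_smul, ContinuousMap.coe_smul, Pi.smul_apply, coeff_apply, smul_eq_mul,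
    Matrix.mul_apply, Finset.sum_mul]
  exact Finset.sum_congr rfl fun b _ => Finset.sum_congr rfl fun a _ => by ring

theorem coeff_mem_of_isSubrep {S : Submodule ℂ (RegAlg G)} {π : URep G ι} {τ : URep G κ}
    (hτ : ∀ a b, coeff τ a b ∈ S) (h : IsSubrep π τ) (i j : ι) : coeff π i j ∈ S := by
  obtain ⟨V, hV, hint⟩ := h
  obtain ⟨f, hf, hft⟩ := exists_mem_apply_eq_mul_mul hτ Vᴴ V i j
  convert hf
  apply Subtype.ext
  ext t
  -- Intertwining and `V* V = 1` give `V* τ(t) V = V* V π(t) = π(t)`.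
  rw [hft, coeff_apply, Matrix.mul_assoc, ← hint, ← Matrix.mul_assoc, hV, Matrix.one_mul]

/-- The restriction of a unitary representation to an invariant subspace `W`, together with the
isometry onto `W`. -/
theorem exists_restriction (π : URep G ι) (W : Submodule ℂ (EuclideanSpace ℂ ι))
    (hW : ∀ t, ∀ v ∈ W, WithLp.toLp 2 ((π t : Matrix ι ι ℂ) *ᵥ v.ofLp) ∈ W) :
    ∃ (τ : URep G (Fin (Module.finrank ℂ W))) (V : Matrix ι (Fin (Module.finrank ℂ W)) ℂ),
      (∀ t, (π t : Matrix ι ι ℂ) * V = V * (τ t).val) ∧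
      ∀ v : ι → ℂ, (V * Vᴴ) *ᵥ v = (W.starProjection (WithLp.toLp 2 v)).ofLp := by
  let b := stdOrthonormalBasis ℂ W
  let V : Matrix ι (Fin (Module.finrank ℂ W)) ℂ := Matrix.of fun i k => (b k : EuclideanSpace ℂ ι) i
  have hVV : Vᴴ * V = 1 := by
    ext k l
    have h := orthonormal_iff_ite.1 b.orthonormal k l
    rw [Submodule.coe_inner, PiLp.inner_apply] at h
    rw [Matrix.one_apply, ← h, Matrix.mul_apply]
    refine Finset.sum_congr rfl fun i _ => ?_
    simp [V, mul_comm]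
  have hproj : ∀ v : ι → ℂ, (V * Vᴴ) *ᵥ v = (W.starProjection (WithLp.toLp 2 v)).ofLp := by
    intro v
    ext i
    rw [b.starProjection_eq_sum_rankOne, ← Matrix.mulVec_mulVec]
    simp only [sum_apply, InnerProductSpace.rankOne_apply, Matrix.mulVec,
      WithLp.ofLp_sum, Finset.sum_apply, dotProduct, PiLp.inner_apply, WithLp.ofLp_smul,
      Pi.smul_apply, smul_eq_mul]
    refine Finset.sum_congr rfl fun k _ => ?_
    simp [V, mul_comm]
  -- The columns of `π(t) V` lie in `W` by invariance, so the projection `V V*` fixes them. This is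
  -- what makes the compression multiplicative.
  have hinv : ∀ t, V * (Vᴴ * (π t : Matrix ι ι ℂ) * V) = (π t : Matrix ι ι ℂ) * V := by
    intro t
    rw [Matrix.mul_assoc, ← Matrix.mul_assoc V]
    ext i k
    have hk : WithLp.toLp 2 ((π t : Matrix ι ι ℂ) *ᵥ (b k : EuclideanSpace ℂ ι).ofLp) ∈ W :=
      hW t _ (b k).2
    have h := hproj ((π t : Matrix ι ι ℂ) *ᵥ (b k : EuclideanSpace ℂ ι).ofLp)
    rw [Submodule.starProjection_eq_self_iff.2 hk] at h
    exact congrFun h i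
  have hstar : ∀ t, star (Vᴴ * (π t : Matrix ι ι ℂ) * V)
      = Vᴴ * ((π t⁻¹ : Matrix.unitaryGroup ι ℂ) : Matrix ι ι ℂ) * V := by
    intro t
    rw [map_inv, Matrix.UnitaryGroup.inv_val]
    simp only [Matrix.star_eq_conjTranspose, Matrix.conjTranspose_mul,
      Matrix.conjTranspose_conjTranspose, Matrix.mul_assoc]
  have hmul : ∀ s t, Vᴴ * ((π (s * t) : Matrix.unitaryGroup ι ℂ) : Matrix ι ι ℂ) * V
      = (Vᴴ * (π s : Matrix ι ι ℂ) * V) * (Vᴴ * (π t : Matrix ι ι ℂ) * V) := by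
    intro s t
    rw [Matrix.mul_assoc (Vᴴ * _) V, hinv, map_mul, Matrix.UnitaryGroup.mul_val]
    simp only [Matrix.mul_assoc]
  have hone : Vᴴ * ((π 1 : Matrix.unitaryGroup ι ℂ) : Matrix ι ι ℂ) * V = 1 := by
    rw [map_one, Matrix.UnitaryGroup.one_val, Matrix.mul_one, hVV]
  have hcont : Continuous fun t => (π t : Matrix ι ι ℂ) :=
    continuous_subtype_val.comp π.continuous_toFun
  have hmem : ∀ t, Vᴴ * (π t : Matrix ι ι ℂ) * V ∈ Matrix.unitaryGroup _ ℂ := fun t => by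
    rw [Matrix.mem_unitaryGroup_iff, hstar, ← hmul, mul_inv_cancel, hone]
  exact ⟨{ toFun := fun t => ⟨Vᴴ * (π t : Matrix ι ι ℂ) * V, hmem t⟩
           map_one' := Subtype.ext hone
           map_mul' := fun s t => Subtype.ext (hmul s t)
           continuous_toFun := Continuous.subtype_mk (by fun_prop) _ }, V,
    fun t => (hinv t).symm, hproj⟩

/-- Unitarity: `π(t)* = π(t⁻¹)` also preserves `W`, so `π(t)` can be moved across the inner product.
-/
theorem mem_orthogonal_of_invariant (π : URep G ι) {W : Submodule ℂ (EuclideanSpace ℂ ι)}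
    (hW : ∀ t, ∀ v ∈ W, WithLp.toLp 2 ((π t : Matrix ι ι ℂ) *ᵥ v.ofLp) ∈ W) (t : G)
    (v : EuclideanSpace ℂ ι) (hv : v ∈ Wᗮ) :
    WithLp.toLp 2 ((π t : Matrix ι ι ℂ) *ᵥ v.ofLp) ∈ Wᗮ := by
  rw [Submodule.mem_orthogonal] at hv ⊢
  intro u hu
  have h := hv _ (hW t⁻¹ u hu)
  rw [map_inv, Matrix.UnitaryGroup.inv_val, Matrix.star_eq_conjTranspose] at h
  rw [← h, EuclideanSpace.inner_eq_star_dotProduct, EuclideanSpace.inner_eq_star_dotProduct,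
    Matrix.star_mulVec, Matrix.conjTranspose_conjTranspose, dotProduct_comm, dotProduct_comm v.ofLp,
    ← Matrix.dotProduct_mulVec]

/-- Complete reducibility: a subspace of `ℂ[G]` that contains the matrix coefficients of the
irreducible unitary representations contains those of all finite-dimensional ones. -/
theorem coeff_mem_of_forall_irreducible {S : Submodule ℂ (RegAlg G)}
    (hS : ∀ (κ : Type) [Fintype κ] [DecidableEq κ] (τ : URep G κ), (toRep τ).IsIrreducible →
      ∀ a b, coeff τ a b ∈ S)
    (π : URep G ι) (i j : ι) : coeff π i j ∈ S := by
  induction h : Fintype.card ι using Nat.strong_induction_on generalizing ι with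
  | _ d ih =>
  by_cases hirr : (toRep π).IsIrreducible
  · exact hS ι π hirr i j
  obtain ⟨U, hbot, htop⟩ : ∃ U : Subrepresentation (toRep π), U ≠ ⊥ ∧ U ≠ ⊤ := by
    by_contra! hU
    -- The index `i` rules out the zero space, which is not irreducible but has no proper nonzero
    -- subspace either.
    have : Nontrivial (Subrepresentation (toRep π)) := by
      refine ⟨⊥, ⊤, fun hbt => ?_⟩
      have h1 : (Pi.single i 1 : ι → ℂ) ∈ (⊤ : Subrepresentation (toRep π)) := Submodule.mem_top
      rw [← hbt] at h1
      have h2 : (Pi.single i 1 : ι → ℂ) = 0 := (Submodule.mem_bot ℂ).1 h1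
      simpa using congrFun h2 i
    exact hirr { eq_bot_or_eq_top := fun U => or_iff_not_imp_left.2 (hU U) }
  -- Moving `U` to Euclidean space provides an orthogonal complement; both pieces have smaller
  -- dimension, so induction applies to each.
  let W : Submodule ℂ (EuclideanSpace ℂ ι) :=
    U.toSubmodule.comap (WithLp.linearEquiv 2 ℂ (ι → ℂ)).toLinearMap
  have hW : ∀ t, ∀ v ∈ W, WithLp.toLp 2 ((π t : Matrix ι ι ℂ) *ᵥ v.ofLp) ∈ W :=
    fun t v hv => U.apply_mem_toSubmodule t hv
  have hWbot : W ≠ ⊥ := by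
    intro hW0
    apply hbot
    apply Subrepresentation.toSubmodule_injective
    refine (Submodule.eq_bot_iff _).2 fun v hv => ?_
    have hv' : WithLp.toLp 2 v ∈ W := hv
    rw [hW0, Submodule.mem_bot] at hv'
    exact congrArg WithLp.ofLp hv'
  have hWtop : W ≠ ⊤ := by
    intro hW1
    apply htop
    apply Subrepresentation.toSubmodule_injective
    refine Submodule.eq_top_iff'.2 fun v => ?_
    have hv' : WithLp.toLp 2 v ∈ W := hW1 ▸ Submodule.mem_top
    exact hv'
  have hlt : Module.finrank ℂ W < Fintype.card ι := by
    simpa using Submodule.finrank_lt hWtop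
  have hpos : 0 < Module.finrank ℂ W := by
    rwa [Nat.pos_iff_ne_zero, Ne, Submodule.finrank_eq_zero]
  have hlt' : Module.finrank ℂ Wᗮ < Fintype.card ι := by
    have hsum := W.finrank_add_finrank_orthogonal
    rw [finrank_euclideanSpace] at hsum
    omega
  obtain ⟨τ, V, hV, hVp⟩ := exists_restriction π W hW
  obtain ⟨τ', V', hV', hVp'⟩ := exists_restriction π Wᗮ (mem_orthogonal_of_invariant π hW)
  have hdecomp : V * Vᴴ + V' * V'ᴴ = 1 := by
    apply Matrix.mulVec_injective
    ext v : 1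
    rw [Matrix.add_mulVec, hVp, hVp', Matrix.one_mulVec, ← WithLp.ofLp_add,
      Submodule.starProjection_orthogonal_val, add_sub_cancel]
  obtain ⟨f, hf, hft⟩ := exists_mem_apply_eq_mul_mul
    (fun a b => ih _ (h ▸ hlt) τ a b (Fintype.card_fin _)) V Vᴴ i j
  obtain ⟨f', hf', hft'⟩ := exists_mem_apply_eq_mul_mul
    (fun a b => ih _ (h ▸ hlt') τ' a b (Fintype.card_fin _)) V' V'ᴴ i j
  convert S.add_mem hf hf'
  apply Subtype.ext
  ext t
  -- Multiply `V V* + V' V'* = 1` on the left by `π(t)` and intertwine.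
  have hmat : (π t : Matrix ι ι ℂ)
      = V * (τ t).val * Vᴴ + V' * (τ' t).val * V'ᴴ := by
    rw [← hV, ← hV', Matrix.mul_assoc, Matrix.mul_assoc, ← Matrix.mul_add, hdecomp, Matrix.mul_one]
  have hadd : ((f + f' : RegAlg G) : C(G, ℂ)) t = (f : C(G, ℂ)) t + (f' : C(G, ℂ)) t := rfl
  rw [hadd, hft, hft', coeff_apply]
  exact congrFun (congrFun hmat i) j

/-- Sesquilinearity expands a coefficient at arbitrary vectors into those at basis vectors. -/
theorem eq_top_of_forall_coeff_mem {S : Submodule ℂ (RegAlg G)}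
    (hS : ∀ (κ : Type) [Fintype κ] [DecidableEq κ] (τ : URep G κ) (a b : κ), coeff τ a b ∈ S) :
    S = ⊤ := by
  have hle : Submodule.span ℂ (matrixCoeffs G) ≤ S.map (RegAlg G).val.toLinearMap := by
    rw [Submodule.span_le]
    rintro _ ⟨κ, _, _, τ, ξ, η, rfl⟩
    refine ⟨∑ i, ∑ j, (ξ j * star (η i)) • coeff τ i j,
      S.sum_mem fun i _ => S.sum_mem fun j _ => S.smul_mem _ (hS κ τ i j), ?_⟩
    ext t
    simp only [map_sum, map_smul, AlgHom.toLinearMap_apply, Subalgebra.coe_val,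
      ContinuousMap.coe_sum, Finset.sum_apply, ContinuousMap.coe_smul, Pi.smul_apply, coeff_apply,
      smul_eq_mul, coeffVec_apply, dotProduct, Matrix.mulVec, Pi.star_apply, Finset.sum_mul]
    exact Finset.sum_congr rfl fun i _ => Finset.sum_congr rfl fun j _ => by ring
  refine Submodule.eq_top_iff'.2 fun f => ?_
  obtain ⟨g, hg, hgf⟩ := hle f.2
  rwa [← Subtype.ext (a1 := g) (a2 := f) hgf]

theorem span_coeff_tensorPow_eq_top {P : URep G ι} (hP : Generating P) :
    Submodule.span ℂ {f | ∃ (l : ℕ) (I J : Fin l → ι), f = coeff (tensorPow P l) I J} = ⊤ := by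
  refine eq_top_of_forall_coeff_mem fun κ _ _ τ a b =>
    coeff_mem_of_forall_irreducible (fun κ _ _ τ hτ a b => ?_) τ a b
  obtain ⟨l, hl⟩ := hP κ τ hτ
  refine coeff_mem_of_isSubrep (fun I J => Submodule.subset_span ?_) hl a b
  exact ⟨l, I, J, rfl⟩

theorem repSeq_injective {m : ℕ} {P : URep G ι} (hP : Generating P) :
    Function.Injective (repSeq m P) := by
  intro x y hxy
  ext1 p q
  refine LinearMap.ext_on (span_coeff_tensorPow_eq_top hP) ?_
  rintro _ ⟨l, I, J, rfl⟩
  exact congrFun (congrFun (congrFun hxy l) (p, I)) (q, J)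

end Decomposition

end QRW

theorem proposition5p1
    {G : Type*} [Group G] [TopologicalSpace G] [IsTopologicalGroup G] [CompactSpace G] [T2Space G]
    {H : Type*} [NormedAddCommGroup H] [InnerProductSpace ℂ H] [CompleteSpace H]
    {n : ℕ} (b : OrthonormalBasis (Fin n) ℂ H)
    (P : G →ₜ* unitary (H →L[ℂ] H))
    (ρ : (H →L[ℂ] H) →ₗ[ℂ] ℂ)
    (hρ : QRW.PositiveFunctional ρ) (hρf : QRW.FaithfulFunctional ρ)
    (m : ℕ) :
    Set.MapsTo (QRW.repSeq m (QRW.toMatrixRep b P))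
      (QRW.subharmonicCone m (QRW.reprElem (QRW.toMatrixRep b P) (QRW.toMatrixFunctional b ρ)))
      (QRW.submartingaleCone m (QRW.toMatrixFunctional b ρ)) ∧
    (QRW.Generating (QRW.toMatrixRep b P) →
      Function.Injective (QRW.repSeq m (QRW.toMatrixRep b P))) :=
  ⟨QRW.mapsTo_repSeq _ _, QRW.repSeq_injective⟩
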